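/- Let $F$ be an Archimedean vector lattice (a real vector lattice in which $x,y\ge 0$ and $ny\le x$ for all $n\in\mathbb N$ imply $y=0$), let $r,s\in\mathbb R$ with $s\neq -r$, and define $\Phi:F\to F$ by $\Phi(f)=rf^{+}+sf^{-}$, where $f^{+}=f\vee 0$ and $f^{-}=(-f)\vee 0$. For $A\subset F_{+}=\{f\in F: f\ge 0\}$ let $\mathrm{vlt}(A)$ denote the linear sublattice of $F$ generated by $A$. Then $\mathrm{span}\,\Phi(\mathrm{span}\,A)$ is a relatively uniformly dense subspace of $\mathrm{vlt}(A)$. That is, $\mathrm{span}\,\Phi(\mathrm{span}\,A)\subset\mathrm{vlt}(A)$, and for every $f\in\mathrm{vlt}(A)$ there are a positive element $e\in\mathrm{vlt}(A)$ and a net $(f_\alpha)$ in $\mathrm{span}\,\Phi(\mathrm{span}\,A)$ which converges to $f$ uniformly relative to $e$: the element $f$ belongs to the principal ideal $F_e=\{g\in F: |g|\le\lambda e\text{ for some }\lambda\ge 0\}$, and for every $\varepsilon>0$ there is $\alpha_0$ such that $f_\alpha\in F_e$ and $\|f-f_\alpha\|_e\le\varepsilon$ for all $\alpha\ge\alpha_0$,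 where $\|g\|_e=\inf\{\lambda\ge 0: |g|\le\lambda e\}$. -/

import Mathlib

open Set

section VectorLattice

variable {F : Type*} [AddCommGroup F] [Lattice F] [Module ℝ F]

/-- A vector lattice `F` is *Archimedean* if whenever `x, y ≥ 0` and `n y ≤ x` for all `n ∈ ℕ`, then
`y = 0`. (Mathlib's class `Archimedean` is a different, stronger notion: it asks that every
strictly positive element be an order unit.) -/
def IsArchimedeanVectorLattice (F : Type*) [AddCommGroup F] [Lattice F] : Prop :=
  ∀ x y : F, 0 ≤ x → 0 ≤ y → (∀ n : ℕ, n • y ≤ x) → y = 0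

/-- The linear sublattice `vlt(A)` of `F` generated by `A`: the intersection of all linear subspaces
containing `A` that are closed under `⊔` and `⊓`. -/
def vlt (A : Set F) : Submodule ℝ F :=
  sInf {E : Submodule ℝ F | A ⊆ (E : Set F) ∧ IsSublattice (E : Set F)}

/-- The map `Φ(f) = r f⁺ + s f⁻`, where `f⁺ = f ⊔ 0` and `f⁻ = (-f) ⊔ 0`. -/
def piecewiseLinearMap (r s : ℝ) (f : F) : F := r • f⁺ + s • f⁻

/-- The principal ideal `F_e` of `F` generated by `e`. -/
def principalIdeal (e : F) : Set F := {f | ∃ α : ℝ, 0 ≤ α ∧ |f| ≤ α • e}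

/-- The norm `‖f‖_e = inf {α ≥ 0 : |f| ≤ α e}`, meaningful for `f ∈ F_e`. -/
noncomputable def relNorm (e f : F) : ℝ := sInf {α : ℝ | 0 ≤ α ∧ |f| ≤ α • e}

/-- The net `u` converges to `f` uniformly relative to `e`. -/
def ConvergesUniformlyRel {ι : Type*} [Preorder ι] (e : F) (u : ι → F) (f : F) : Prop :=
  f ∈ principalIdeal e ∧
    ∀ ε : ℝ, 0 < ε → ∃ i₀ : ι, ∀ i : ι, i₀ ≤ i →
      u i ∈ principalIdeal e ∧ relNorm e (f - u i) ≤ ε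

/-- `D` is a *relatively uniformly dense subspace* of the linear sublattice `E`: it is contained
in `E`, and every element of `E` is the limit of a net of elements of `D` that converges uniformly
relative to some positive element `e` of the vector lattice `E`. -/
def IsRelUniformlyDenseSubspace (D E : Submodule ℝ F) : Prop :=
  D ≤ E ∧ ∀ f ∈ E, ∃ e ∈ E, 0 ≤ e ∧
    ∃ (ι : Type) (_ : Preorder ι) (_ : IsDirectedOrder ι) (_ : Nonempty ι) (u : ι → F),
      (∀ i, u i ∈ D) ∧ ConvergesUniformlyRel e u f

end VectorLattice

/-! An element `f` of `vlt A` is a lattice expression in linear combinations of finitely many `a i ∈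
A`. The same expression in the coordinate forms is a continuous function `g` on the standard
simplex. Let `W` be the sublattice of `C(stdSimplex) × F` generated by the pairs `formPair a c`. If
the first component of an element of `W` is nonnegative, so is the second
(`snd_nonneg_of_mem_latticeClosure`, via Hahn–Banach in `exists_mem_convexHull_nonneg`), so uniform
estimates on the simplex become order estimates in `F`, with `∑ i, a i` in the role of `1`. On the
simplex, absolute values of linear forms span a dense subspace
(`topologicalClosure_span_abs_eq_top`): integrating `exp u * |h - u|` in `u` produces `exp h`, and
Stone–Weierstrass applies to these exponentials. Finally, `|v|` is a multiple of `Φ(v) + Φ(-v)`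
because `r + s ≠ 0`. -/

section Density

/-! ### Density of spans of absolute values in `C(X, ℝ)` -/

/-- An integral representation of the exponential function by absolute values. -/
lemma integral_exp_mul_abs_sub {a b t : ℝ} (hat : a ≤ t) (htb : t ≤ b) :
    ∫ u in a..b, Real.exp u * |t - u| =
      2 * Real.exp t - (t - a + 1) * Real.exp a + (b - t - 1) * Real.exp b := by
  have hc : Continuous fun u : ℝ => Real.exp u * |t - u| := by fun_prop
  rw [← intervalIntegral.integral_add_adjacent_intervals (hc.intervalIntegrable a t)
    (hc.intervalIntegrable t b)]
  have h₁ : ∫ u in a..t, Real.exp u * |t - u| = Real.exp t - (t - a + 1) * Real.exp a := by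
    have hd : ∀ u : ℝ, HasDerivAt (fun u => (t - u + 1) * Real.exp u)
        (Real.exp u * (t - u)) u := fun u => by
      have := (((hasDerivAt_id u).const_sub t).add_const 1).mul (Real.hasDerivAt_exp u)
      refine this.congr_deriv ?_
      simp only [id]
      ring
    have hi := intervalIntegral.integral_eq_sub_of_hasDerivAt (a := a) (b := t)
      (fun u _ => hd u) (Continuous.intervalIntegrable (by fun_prop) a t)
    calc _ = ∫ u in a..t, Real.exp u * (t - u) := by
            refine intervalIntegral.integral_congr fun u hu => ?_
            rw [uIcc_of_le hat] at hu
            simp only [abs_of_nonneg (sub_nonneg.2 hu.2)]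
      _ = _ := by rw [hi]; ring
  have h₂ : ∫ u in t..b, Real.exp u * |t - u| = (b - t - 1) * Real.exp b + Real.exp t := by
    have hd : ∀ u : ℝ, HasDerivAt (fun u => (u - t - 1) * Real.exp u)
        (Real.exp u * (u - t)) u := fun u => by
      have := (((hasDerivAt_id u).sub_const t).sub_const 1).mul (Real.hasDerivAt_exp u)
      refine this.congr_deriv ?_
      simp only [id]
      ring
    have hi := intervalIntegral.integral_eq_sub_of_hasDerivAt (a := t) (b := b)
      (fun u _ => hd u) (Continuous.intervalIntegrable (by fun_prop) t b)
    calc _ = ∫ u in t..b, Real.exp u * (u - t) := by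
            refine intervalIntegral.integral_congr fun u hu => ?_
            rw [uIcc_of_le htb] at hu
            simp only [abs_of_nonpos (sub_nonpos.2 hu.1), neg_sub]
      _ = _ := by rw [hi]; ring
  rw [h₁, h₂]; ring

/-- The composition of a continuous function with the exponential function. -/
noncomputable def ContinuousMap.realExp {X : Type*} [TopologicalSpace X] (h : C(X, ℝ)) : C(X, ℝ) :=
  ⟨fun x => Real.exp (h x), by fun_prop⟩

variable {X : Type*} [TopologicalSpace X] [CompactSpace X]

/-- The integral of `exp u • |h - u|` over `[-‖h‖, ‖h‖]` stays in the closed subspace `M`, and it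
equals `2 exp h` up to a combination of `h` and `1`. -/
lemma realExp_mem_of_abs_sub_const_mem {M : Submodule ℝ C(X, ℝ)} (hM : IsClosed (M : Set C(X, ℝ)))
    (h : C(X, ℝ)) (h_one : (1 : C(X, ℝ)) ∈ M) (hh : h ∈ M)
    (h_abs : ∀ u : ℝ, |h - u • (1 : C(X, ℝ))| ∈ M) : h.realExp ∈ M := by
  have : CompleteSpace M := hM.completeSpace_coe
  have hcont : Continuous fun u : ℝ => Real.exp u • |h - u • (1 : C(X, ℝ))| := by
    refine Real.continuous_exp.smul (ContinuousMap.continuous_of_continuous_uncurry _ ?_)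
    change Continuous fun p : ℝ × X => |h p.2 - p.1 • (1 : ℝ)|
    fun_prop
  -- Integrating inside the complete space `M` makes membership of the integral automatic.
  let G : ℝ → M := fun u => ⟨Real.exp u • |h - u • (1 : C(X, ℝ))|, M.smul_mem _ (h_abs u)⟩
  have hG : Continuous G := hcont.subtype_mk _
  set b : ℝ := ‖h‖
  have hI := ContinuousLinearMap.intervalIntegral_comp_comm (𝕜 := ℝ) (E := M) (F := C(X, ℝ))
    M.subtypeL (hG.intervalIntegrable (-b) b)
    (μ := MeasureTheory.volume)
  have hImem : (∫ u in (-b)..b, Real.exp u • |h - u • (1 : C(X, ℝ))|) ∈ M := by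
    have : (∫ u in (-b)..b, Real.exp u • |h - u • (1 : C(X, ℝ))|)
        = ((∫ u in (-b)..b, G u : M) : C(X, ℝ)) := hI
    rw [this]
    exact Subtype.coe_prop _
  have hval : ∀ x, (∫ u in (-b)..b, Real.exp u • |h - u • (1 : C(X, ℝ))|) x =
      2 * Real.exp (h x) - (h x + b + 1) * Real.exp (-b) + (b - h x - 1) * Real.exp b := by
    intro x
    have hev := (ContinuousMap.evalCLM ℝ x : C(X, ℝ) →L[ℝ] ℝ).intervalIntegral_comp_comm
      (hcont.intervalIntegrable (-b) b) (μ := MeasureTheory.volume)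
    have hx : |h x| ≤ b := h.norm_coe_le_norm x
    have := integral_exp_mul_abs_sub (abs_le.1 hx).1 (abs_le.1 hx).2
    rw [sub_neg_eq_add] at this
    rw [← this]
    refine hev.symm.trans (intervalIntegral.integral_congr fun u _ => ?_)
    simp [ContinuousMap.abs_apply]
  have hexp : h.realExp = (1 / 2 : ℝ) • ((∫ u in (-b)..b, Real.exp u • |h - u • (1 : C(X, ℝ))|)
      + (Real.exp (-b) + Real.exp b) • h
      + ((b + 1) * Real.exp (-b) - (b - 1) * Real.exp b) • (1 : C(X, ℝ))) := by
    ext x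
    simp only [ContinuousMap.smul_apply, ContinuousMap.add_apply, hval x, ContinuousMap.one_apply,
      smul_eq_mul]
    simp only [ContinuousMap.realExp, ContinuousMap.coe_mk]
    ring
  rw [hexp]
  exact M.smul_mem _ (M.add_mem (M.add_mem hImem (M.smul_mem _ hh)) (M.smul_mem _ h_one))

/-- The absolute values of the elements of a point-separating space of continuous functions that
contains the constants span a dense subspace. -/
lemma topologicalClosure_span_abs_eq_top (V : Submodule ℝ C(X, ℝ)) (h_one : (1 : C(X, ℝ)) ∈ V)
    (hsep : ∀ x y : X, x ≠ y → ∃ h ∈ V, h x ≠ h y) :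
    (Submodule.span ℝ {g : C(X, ℝ) | ∃ h ∈ V, g = |h|}).topologicalClosure = ⊤ := by
  set D := Submodule.span ℝ {g : C(X, ℝ) | ∃ h ∈ V, g = |h|}
  have habs : ∀ h ∈ V, |h| ∈ D := fun h hh => Submodule.subset_span ⟨h, hh, rfl⟩
  have hone : (1 : C(X, ℝ)) ∈ D := by
    have := habs 1 h_one
    rwa [abs_of_nonneg (zero_le_one : (0 : C(X, ℝ)) ≤ 1)] at this
  have hVD : V ≤ D := fun h hh => by
    -- Shifted by `‖h‖`, the function is its own absolute value.
    have hnn : 0 ≤ h + ‖h‖ • (1 : C(X, ℝ)) := fun x => by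
      have := (abs_le.1 (h.norm_coe_le_norm x)).1
      change 0 ≤ h x + ‖h‖ * 1
      linarith
    have h1 := habs _ (V.add_mem hh (V.smul_mem ‖h‖ h_one))
    rw [abs_of_nonneg hnn] at h1
    simpa using D.sub_mem h1 (D.smul_mem ‖h‖ hone)
  have hDM : D ≤ D.topologicalClosure := D.le_topologicalClosure
  have hexp : ∀ h ∈ V, h.realExp ∈ D.topologicalClosure := fun h hh =>
    realExp_mem_of_abs_sub_const_mem D.isClosed_topologicalClosure h (hDM hone) (hDM (hVD hh))
      fun u => hDM (habs _ (V.sub_mem hh (V.smul_mem u h_one)))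
  -- Since `exp h * exp k = exp (h + k)`, the algebra generated by these exponentials is merely
  -- their linear span.
  let S : Submonoid C(X, ℝ) :=
    { carrier := {g | ∃ h ∈ V, g = h.realExp}
      one_mem' := ⟨0, V.zero_mem, by ext x; simp [ContinuousMap.realExp]⟩
      mul_mem' := by
        rintro _ _ ⟨h, hh, rfl⟩ ⟨k, hk, rfl⟩
        exact ⟨h + k, V.add_mem hh hk, by ext x; simp [ContinuousMap.realExp, Real.exp_add]⟩ }
  have hadj : Subalgebra.toSubmodule (Algebra.adjoin ℝ (S : Set C(X, ℝ))) ≤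
      D.topologicalClosure := by
    rw [Algebra.adjoin_eq_span, Submonoid.closure_eq, Submodule.span_le]
    rintro _ ⟨h, hh, rfl⟩
    exact hexp h hh
  have hsw := ContinuousMap.subalgebra_topologicalClosure_eq_top_of_separatesPoints
    (Algebra.adjoin ℝ (S : Set C(X, ℝ))) (by
      intro x y hxy
      obtain ⟨h, hh, hne⟩ := hsep x y hxy
      exact ⟨_, ⟨h.realExp, Algebra.subset_adjoin ⟨h, hh, rfl⟩, rfl⟩,
        fun H => hne (Real.exp_injective H)⟩)
  rw [eq_top_iff]
  intro g _
  have hg : g ∈ (Algebra.adjoin ℝ (S : Set C(X, ℝ))).topologicalClosure := by rw [hsw]; trivial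
  exact closure_minimal hadj D.isClosed_topologicalClosure hg

end Density

/-! ### Generated sublattices and the map `Φ` -/

section LatticeClosure

variable {G : Type*} [AddCommGroup G] [Lattice G]

lemma isSublattice_preimage_neg [IsOrderedAddMonoid G] {s : Set G} (hs : IsSublattice s) :
    IsSublattice {x : G | -x ∈ s} :=
  ⟨fun a ha b hb => by simpa [neg_sup] using hs.infClosed ha hb,
    fun a ha b hb => by simpa [neg_inf] using hs.supClosed ha hb⟩

lemma isSublattice_preimage_add_right [IsOrderedAddMonoid G] {s : Set G} (hs : IsSublattice s) (v : G) :
    IsSublattice {x : G | x + v ∈ s} :=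
  ⟨fun a ha b hb => by simpa [sup_add] using hs.supClosed ha hb,
    fun a ha b hb => by simpa [inf_add] using hs.infClosed ha hb⟩

lemma smul_sup_of_pos [Module ℝ G] [IsOrderedModule ℝ G] {c : ℝ} (hc : 0 < c) (a b : G) :
    c • (a ⊔ b) = c • a ⊔ c • b :=
  (OrderIso.smulRight hc).map_sup a b

lemma smul_inf_of_pos [Module ℝ G] [IsOrderedModule ℝ G] {c : ℝ} (hc : 0 < c) (a b : G) :
    c • (a ⊓ b) = c • a ⊓ c • b :=
  (OrderIso.smulRight hc).map_inf a b

lemma isSublattice_preimage_smul [IsOrderedAddMonoid G] [Module ℝ G] [IsOrderedModule ℝ G] {s : Set G} (hs : IsSublattice s) {c : ℝ}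
    (hc : 0 < c) : IsSublattice {x : G | c • x ∈ s} :=
  ⟨fun a ha b hb => by
      have := hs.supClosed ha hb
      rwa [← smul_sup_of_pos hc] at this,
    fun a ha b hb => by
      have := hs.infClosed ha hb
      rwa [← smul_inf_of_pos hc] at this⟩

/-- The sublattice generated by a linear subspace is a linear subspace. -/
def Submodule.latticeClosure [IsOrderedAddMonoid G] [Module ℝ G] [IsOrderedModule ℝ G] (V : Submodule ℝ G) : Submodule ℝ G where
  carrier := _root_.latticeClosure (V : Set G)
  zero_mem' := subset_latticeClosure V.zero_mem
  add_mem' := by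
    intro a b ha hb
    -- Stability under addition comes in two stages: one summand in `V`, then both in the closure.
    have h₁ : ∀ v ∈ V, ∀ x ∈ _root_.latticeClosure (V : Set G),
        x + v ∈ _root_.latticeClosure (V : Set G) := fun v hv =>
      latticeClosure_min (fun x hx => subset_latticeClosure (V.add_mem hx hv))
        (isSublattice_preimage_add_right isSublattice_latticeClosure v)
    exact latticeClosure_min (fun x hx => by
        have := h₁ x hx b hb
        rwa [add_comm] at this)
      (isSublattice_preimage_add_right isSublattice_latticeClosure b) ha
  smul_mem' := by
    have hpos : ∀ c : ℝ, 0 < c → ∀ x ∈ _root_.latticeClosure (V : Set G),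
        c • x ∈ _root_.latticeClosure (V : Set G) := fun c hc =>
      latticeClosure_min (fun x hx => subset_latticeClosure (V.smul_mem c hx))
        (isSublattice_preimage_smul isSublattice_latticeClosure hc)
    have hneg : ∀ x ∈ _root_.latticeClosure (V : Set G),
        -x ∈ _root_.latticeClosure (V : Set G) :=
      latticeClosure_min (fun x hx => subset_latticeClosure (V.neg_mem hx))
        (isSublattice_preimage_neg isSublattice_latticeClosure)
    intro c x hx
    rcases lt_trichotomy c 0 with hc | rfl | hc
    · simpa using hneg _ (hpos (-c) (neg_pos.2 hc) x hx)
    · simpa using subset_latticeClosure V.zero_mem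
    · exact hpos c hc x hx

lemma Submodule.isSublattice_latticeClosure [IsOrderedAddMonoid G] [Module ℝ G] [IsOrderedModule ℝ G] (V : Submodule ℝ G) :
    IsSublattice (V.latticeClosure : Set G) := _root_.isSublattice_latticeClosure

lemma Submodule.le_latticeClosure [IsOrderedAddMonoid G] [Module ℝ G] [IsOrderedModule ℝ G] (V : Submodule ℝ G) :
    V ≤ V.latticeClosure := subset_latticeClosure

lemma Submodule.abs_mem_latticeClosure [IsOrderedAddMonoid G] [Module ℝ G] [IsOrderedModule ℝ G] (V : Submodule ℝ G) {x : G}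
    (hx : x ∈ V.latticeClosure) : |x| ∈ V.latticeClosure :=
  V.isSublattice_latticeClosure.supClosed hx (V.latticeClosure.neg_mem hx)

/-- Lattice-ordered groups are distributive, which gives the normal form: finite infima of finite
suprema. -/
lemma infClosure_supClosure_eq_latticeClosure [IsOrderedAddMonoid G] (s : Set G) :
    infClosure (supClosure s) = latticeClosure s := by
  let i : DistribLattice G := AddCommGroup.toDistribLattice G
  exact @infClosure_supClosure G i s

lemma vlt_le_latticeClosure [IsOrderedAddMonoid G] [Module ℝ G] [IsOrderedModule ℝ G] (A : Set G) :
    vlt A ≤ (Submodule.span ℝ A).latticeClosure :=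
  sInf_le ⟨fun _ ha => Submodule.le_latticeClosure _ (Submodule.subset_span ha),
    Submodule.isSublattice_latticeClosure _⟩

lemma subset_vlt [Module ℝ G] (A : Set G) : A ⊆ (vlt A : Set G) := fun a ha => by
  simp only [vlt, SetLike.mem_coe, Submodule.mem_sInf]
  exact fun E hE => hE.1 ha

lemma isSublattice_vlt [Module ℝ G] (A : Set G) : IsSublattice (vlt A : Set G) := by
  rw [vlt, Submodule.coe_sInf]
  exact isSublattice_iInter fun E => isSublattice_iInter fun hE => hE.2

lemma piecewiseLinearMap_mem_vlt [IsOrderedAddMonoid G] [Module ℝ G] (r s : ℝ) {A : Set G} {f : G} (hf : f ∈ vlt A) :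
    piecewiseLinearMap r s f ∈ vlt A :=
  (vlt A).add_mem
    ((vlt A).smul_mem r ((isSublattice_vlt A).supClosed hf (vlt A).zero_mem))
    ((vlt A).smul_mem s ((isSublattice_vlt A).supClosed ((vlt A).neg_mem hf) (vlt A).zero_mem))

lemma span_image_piecewiseLinearMap_le_vlt [IsOrderedAddMonoid G] [Module ℝ G] (r s : ℝ) (A : Set G) :
    Submodule.span ℝ (piecewiseLinearMap r s '' (Submodule.span ℝ A : Set G)) ≤ vlt A := by
  rw [Submodule.span_le]
  rintro _ ⟨f, hf, rfl⟩
  exact piecewiseLinearMap_mem_vlt r s (Submodule.span_le.2 (subset_vlt A) hf)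

lemma piecewiseLinearMap_add_piecewiseLinearMap_neg [IsOrderedAddMonoid G] [Module ℝ G] (r s : ℝ) (f : G) :
    piecewiseLinearMap r s f + piecewiseLinearMap r s (-f) = (r + s) • |f| := by
  rw [← posPart_add_negPart f]
  simp only [piecewiseLinearMap, posPart_neg, negPart_neg]
  module

/-- Absolute values belong to the span of the image of a nondegenerate piecewise linear map. -/
lemma abs_mem_span_image_piecewiseLinearMap [IsOrderedAddMonoid G] [Module ℝ G] {r s : ℝ} (hrs : s ≠ -r) (V : Submodule ℝ G) {f : G}
    (hf : f ∈ V) : |f| ∈ Submodule.span ℝ (piecewiseLinearMap r s '' (V : Set G)) := by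
  have hne : r + s ≠ 0 := fun h => hrs (by linarith)
  have h := Submodule.smul_mem (Submodule.span ℝ (piecewiseLinearMap r s '' (V : Set G)))
    (r + s)⁻¹ (Submodule.add_mem _ (Submodule.subset_span ⟨f, hf, rfl⟩)
      (Submodule.subset_span ⟨-f, V.neg_mem hf, rfl⟩))
  rwa [piecewiseLinearMap_add_piecewiseLinearMap_neg, inv_smul_smul₀ hne] at h

lemma exists_finset_mem_latticeClosure_span [Module ℝ G] {A : Set G} {f : G}
    (hf : f ∈ latticeClosure (Submodule.span ℝ A : Set G)) :
    ∃ T : Finset G, (T : Set G) ⊆ A ∧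
      f ∈ latticeClosure (Submodule.span ℝ (T : Set G) : Set G) := by
  classical
  have hmono : ∀ T T' : Finset G, latticeClosure (Submodule.span ℝ (T : Set G) : Set G) ⊆
      latticeClosure (Submodule.span ℝ ((T ∪ T' : Finset G) : Set G) : Set G) := fun T T' =>
    latticeClosure_mono (Submodule.span_mono (by simp))
  refine latticeClosure_min (t := {f | ∃ T : Finset G, (T : Set G) ⊆ A ∧
      f ∈ latticeClosure (Submodule.span ℝ (T : Set G) : Set G)}) ?_ ⟨?_, ?_⟩ hf
  · intro x hx
    obtain ⟨T, hT, hxT⟩ := Submodule.mem_span_finite_of_mem_span hx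
    exact ⟨T, hT, subset_latticeClosure hxT⟩
  · rintro x ⟨T, hT, hx⟩ y ⟨T', hT', hy⟩
    refine ⟨T ∪ T', by simp [hT, hT'], isSublattice_latticeClosure.supClosed (hmono _ _ hx) ?_⟩
    rw [Finset.union_comm]
    exact hmono _ _ hy
  · rintro x ⟨T, hT, hx⟩ y ⟨T', hT', hy⟩
    refine ⟨T ∪ T', by simp [hT, hT'], isSublattice_latticeClosure.infClosed (hmono _ _ hx) ?_⟩
    rw [Finset.union_comm]
    exact hmono _ _ hy

end LatticeClosure

/-! ### Transfer from the simplex to a vector lattice -/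

section Transfer

variable {ι : Type*} [Fintype ι]

/-- Finitely many linear forms whose maximum is nonnegative on the standard simplex have a convex
combination with nonnegative coefficients. -/
lemma exists_mem_convexHull_nonneg {s : Set (ι → ℝ)} (hs : s.Finite)
    (h : ∀ x ∈ stdSimplex ℝ ι, ∃ c ∈ s, 0 ≤ ∑ i, c i * x i) (hne : s.Nonempty) :
    ∃ c ∈ convexHull ℝ s, 0 ≤ c := by
  classical
  by_contra! hcon
  have hclosed : IsClosed (Ici (0 : ι → ℝ)) := isClosed_Ici
  obtain ⟨φ, u, v, hu, huv, hv⟩ := geometric_hahn_banach_compact_closed (convex_convexHull ℝ s)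
    (Set.Finite.isCompact_convexHull (𝕜 := ℝ) hs) (convex_Ici (0 : ι → ℝ)) hclosed
    (Set.disjoint_left.2 fun c hc hc' => hcon c hc hc')
  have hv0 : v < 0 := by simpa using hv 0 self_mem_Ici
  set x : ι → ℝ := fun i => φ (Pi.single i 1) with hxdef
  have hφ : ∀ c : ι → ℝ, φ c = ∑ i, c i * x i := fun c => by
    conv_lhs => rw [pi_eq_sum_univ' c, map_sum]
    refine Finset.sum_congr rfl fun i _ => ?_
    rw [map_smul, smul_eq_mul]
  have hx : ∀ i, 0 ≤ x i := fun i => by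
    by_contra! hi
    -- The scaling is chosen so that `φ` takes the value `v` at this point of the cone, where it
    -- must exceed `v`.
    have h0 : (0 : ι → ℝ) ≤ (v / x i) • Pi.single i 1 := by
      intro j
      have : 0 ≤ v / x i := (div_pos_of_neg_of_neg hv0 hi).le
      by_cases hj : j = i
      · subst hj; simpa using this
      · simp [hj]
    have := hv _ h0
    rw [map_smul, smul_eq_mul] at this
    change v < v / x i * x i at this
    rw [div_mul_cancel₀ _ hi.ne] at this
    exact this.false
  have hneg : ∀ c ∈ s, ∑ i, c i * x i < 0 := fun c hc => by
    rw [← hφ]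
    exact ((hu c (subset_convexHull ℝ s hc)).trans huv).trans hv0
  have hsum : 0 < ∑ i, x i := by
    refine (Finset.sum_nonneg fun i _ => hx i).lt_of_ne fun h0 => ?_
    obtain ⟨c, hc⟩ := hne
    have hz := (Finset.sum_eq_zero_iff_of_nonneg fun i _ => hx i).1 h0.symm
    have := hneg c hc
    rw [Finset.sum_eq_zero fun i hi => by rw [hz i hi, mul_zero]] at this
    exact this.false
  obtain ⟨c, hc, hc0⟩ := h (fun i => (∑ j, x j)⁻¹ * x i)
    ⟨fun i => mul_nonneg (inv_nonneg.2 hsum.le) (hx i), by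
      rw [← Finset.mul_sum, inv_mul_cancel₀ hsum.ne']⟩
  have : ∑ i, c i * ((∑ j, x j)⁻¹ * x i) = (∑ j, x j)⁻¹ * ∑ i, c i * x i := by
    rw [Finset.mul_sum]
    exact Finset.sum_congr rfl fun i _ => by ring
  rw [this] at hc0
  exact hc0.not_gt (mul_neg_of_pos_of_neg (inv_pos.2 hsum) (hneg c hc))

/-- The linear form with coefficients `c`, as a function on the standard simplex. -/
noncomputable def simplexForm : (ι → ℝ) →ₗ[ℝ] C(stdSimplex ℝ ι, ℝ) where
  toFun c := ⟨fun x => ∑ i, c i * x.1 i, continuous_finsetSum _ fun i _ =>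
    continuous_const.mul ((continuous_apply i).comp continuous_subtype_val)⟩
  map_add' c d := by
    ext x
    simp [add_mul, Finset.sum_add_distrib]
  map_smul' r c := by
    ext x
    simp [Finset.mul_sum, mul_assoc]

lemma simplexForm_apply (c : ι → ℝ) (x : stdSimplex ℝ ι) :
    simplexForm c x = ∑ i, c i * x.1 i := rfl

lemma simplexForm_one : simplexForm (1 : ι → ℝ) = 1 := by
  ext x
  simp [simplexForm_apply, x.2.2]

variable {F : Type*} [AddCommGroup F] [Module ℝ F]

/-- The linear map sending coefficients `c` to the pair consisting of the corresponding linear form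
on the simplex and the corresponding linear combination of the vectors `a i`. -/
noncomputable def formPair (a : ι → F) : (ι → ℝ) →ₗ[ℝ] C(stdSimplex ℝ ι, ℝ) × F :=
  simplexForm.prod (Fintype.linearCombination ℝ a)

lemma formPair_apply (a : ι → F) (c : ι → ℝ) :
    formPair a c = (simplexForm c, ∑ i, c i • a i) := rfl

instance ContinuousMap.instIsOrderedModuleReal {X : Type*} [TopologicalSpace X] :
    IsOrderedModule ℝ C(X, ℝ) where
  smul_le_smul_of_nonneg_left _ hr _ _ h x := mul_le_mul_of_nonneg_left (h x) hr
  smul_le_smul_of_nonneg_right _ hf _ _ h x := mul_le_mul_of_nonneg_right h (hf x)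

instance Prod.instIsOrderedModuleReal {E F : Type*} [AddCommGroup E] [PartialOrder E] [Module ℝ E]
    [IsOrderedModule ℝ E] [AddCommGroup F] [PartialOrder F] [Module ℝ F] [IsOrderedModule ℝ F] :
    IsOrderedModule ℝ (E × F) where
  smul_le_smul_of_nonneg_left _ hr _ _ h :=
    ⟨smul_le_smul_of_nonneg_left h.1 hr, smul_le_smul_of_nonneg_left h.2 hr⟩
  smul_le_smul_of_nonneg_right _ hf _ _ h :=
    ⟨smul_le_smul_of_nonneg_right h hf.1, smul_le_smul_of_nonneg_right h hf.2⟩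

variable [Lattice F] [IsOrderedAddMonoid F] [IsOrderedModule ℝ F]

/-- A maximum of linear forms that is nonnegative on the standard simplex is nonnegative at
nonnegative elements of any vector lattice. -/
lemma snd_nonneg_of_mem_supClosure {a : ι → F} (ha : ∀ i, 0 ≤ a i)
    {z : C(stdSimplex ℝ ι, ℝ) × F} (hz : z ∈ supClosure (range (formPair a))) (h : 0 ≤ z.1) :
    0 ≤ z.2 := by
  classical
  obtain ⟨t, htne, htr, htz⟩ := hz
  rw [← image_univ] at htr
  obtain ⟨s, -, rfl⟩ := Finset.subset_set_image_iff.1 htr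
  have hle : ∀ c ∈ s, formPair a c ≤ z := fun c hc =>
    htz ▸ Finset.le_sup' id (Finset.mem_image_of_mem _ hc)
  obtain ⟨c, hc, hc0⟩ := exists_mem_convexHull_nonneg (s := (s : Set (ι → ℝ))) s.finite_toSet
    (fun x hx => by
      by_contra! hneg
      refine (h ⟨x, hx⟩).not_gt ?_
      rw [← htz]
      refine Finset.sup'_induction (p := fun v : C(stdSimplex ℝ ι, ℝ) × F => v.1 ⟨x, hx⟩ < 0)
        htne id (fun v hv w hw => max_lt hv hw) fun v hv => ?_
      obtain ⟨c, hc, rfl⟩ := Finset.mem_image.1 hv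
      exact hneg c hc) (by simpa using htne)
  -- This convex set contains `s`, hence also the nonnegative `c` of its convex hull.
  have hconv : Convex ℝ {c : ι → ℝ | Fintype.linearCombination ℝ a c ≤ z.2} :=
    (convex_Iic z.2).linear_preimage (Fintype.linearCombination ℝ a)
  refine le_trans ?_ (convexHull_min (fun c hc => (hle c hc).2) hconv hc)
  exact Finset.sum_nonneg fun i _ => smul_nonneg (hc0 i) (ha i)

/-- A lattice-linear expression that is nonnegative on the standard simplex is nonnegative at
nonnegative elements of any vector lattice. -/
lemma snd_nonneg_of_mem_latticeClosure {a : ι → F} (ha : ∀ i, 0 ≤ a i)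
    {z : C(stdSimplex ℝ ι, ℝ) × F} (hz : z ∈ latticeClosure (range (formPair a)))
    (h : 0 ≤ z.1) : 0 ≤ z.2 := by
  rw [← infClosure_supClosure_eq_latticeClosure] at hz
  obtain ⟨t, htne, hts, rfl⟩ := hz
  refine Finset.inf'_induction (p := fun v : C(stdSimplex ℝ ι, ℝ) × F => 0 ≤ v.2) htne id
    (fun v hv w hw => le_inf hv hw) fun v hv => ?_
  exact snd_nonneg_of_mem_supClosure ha (hts hv) (h.trans (Finset.inf'_le id hv).1)

/-- Linear combinations of the functions `|l|`, for `l` a linear form, are dense in the continuous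
functions on the standard simplex. -/
lemma exists_mem_span_abs_simplexForm_near (g : C(stdSimplex ℝ ι, ℝ)) {ε : ℝ} (hε : 0 < ε) :
    ∃ h ∈ Submodule.span ℝ {h | ∃ l ∈ LinearMap.range (simplexForm (ι := ι)), h = |l|},
      ‖g - h‖ < ε := by
  classical
  have htop := topologicalClosure_span_abs_eq_top (LinearMap.range (simplexForm (ι := ι)))
    ⟨1, simplexForm_one⟩ fun x y hxy => by
      obtain ⟨i, hi⟩ := Function.ne_iff.1 (Subtype.coe_injective.ne hxy)
      refine ⟨_, ⟨Pi.single i 1, rfl⟩, ?_⟩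
      simpa [simplexForm_apply, Pi.single_apply] using hi
  have hg : g ∈ closure (Submodule.span ℝ
      {h | ∃ l ∈ LinearMap.range (simplexForm (ι := ι)), h = |l|} : Set C(stdSimplex ℝ ι, ℝ)) := by
    rw [← Submodule.topologicalClosure_coe, htop]
    trivial
  obtain ⟨h, hh, hd⟩ := Metric.mem_closure_iff.1 hg ε hε
  exact ⟨h, hh, by rwa [← dist_eq_norm]⟩

/-- Elements of the sublattice generated by finitely many nonnegative vectors are approximated, with
respect to the sum of these vectors, by linear combinations of absolute values of their linear
combinations. -/
lemma exists_mem_span_abs_abs_sub_le {a : ι → F} (ha : ∀ i, 0 ≤ a i) {f : F}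
    (hf : f ∈ latticeClosure (Submodule.span ℝ (range a) : Set F)) {ε : ℝ} (hε : 0 < ε) :
    ∃ d ∈ Submodule.span ℝ {d | ∃ v ∈ Submodule.span ℝ (range a), d = |v|},
      |f - d| ≤ ε • ∑ i, a i := by
  set V := LinearMap.range (formPair a)
  have hV : (V : Set (C(stdSimplex ℝ ι, ℝ) × F)) = range (formPair a) := LinearMap.coe_range _
  set W := V.latticeClosure
  have hspan : ∀ c : ι → ℝ, ∑ i, c i • a i ∈ Submodule.span ℝ (range a) := fun c =>
    Submodule.sum_mem _ fun i _ => Submodule.smul_mem _ _ (Submodule.subset_span ⟨i, rfl⟩)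
  have hpos : ∀ z ∈ W, 0 ≤ z.1 → 0 ≤ z.2 := fun z hz h0 =>
    snd_nonneg_of_mem_latticeClosure ha (hV ▸ hz) h0
  -- The second components of `W` form a sublattice containing the span of the `a i`.
  obtain ⟨g, hg⟩ : ∃ g, (g, f) ∈ W := by
    refine latticeClosure_min (t := {f | ∃ g, (g, f) ∈ W}) (fun v hv => ?_)
      ⟨fun x ⟨g, hg⟩ y ⟨k, hk⟩ => ⟨_, V.isSublattice_latticeClosure.supClosed hg hk⟩,
        fun x ⟨g, hg⟩ y ⟨k, hk⟩ => ⟨_, V.isSublattice_latticeClosure.infClosed hg hk⟩⟩ hf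
    obtain ⟨c, rfl⟩ := (Submodule.mem_span_range_iff_exists_fun ℝ).1 hv
    exact ⟨_, V.le_latticeClosure ⟨c, formPair_apply a c⟩⟩
  obtain ⟨h, hh, hgh⟩ := exists_mem_span_abs_simplexForm_near g hε
  obtain ⟨d, hd, hhd⟩ : ∃ d ∈ Submodule.span ℝ {d | ∃ v ∈ Submodule.span ℝ (range a), d = |v|},
      (h, d) ∈ W := by
    clear hgh
    induction hh using Submodule.span_induction with
    | mem h hh =>
      obtain ⟨_, ⟨c, rfl⟩, rfl⟩ := hh
      exact ⟨_, Submodule.subset_span ⟨_, hspan c, rfl⟩,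
        V.abs_mem_latticeClosure (V.le_latticeClosure ⟨c, rfl⟩)⟩
    | zero => exact ⟨0, Submodule.zero_mem _, W.zero_mem⟩
    | add h k _ _ hh hk =>
      obtain ⟨d, hd, hhd⟩ := hh
      obtain ⟨d', hd', hkd'⟩ := hk
      exact ⟨d + d', Submodule.add_mem _ hd hd', W.add_mem hhd hkd'⟩
    | smul r h _ hh =>
      obtain ⟨d, hd, hhd⟩ := hh
      exact ⟨r • d, Submodule.smul_mem _ r hd, W.smul_mem r hhd⟩
  refine ⟨d, hd, ?_⟩
  have hone : ((1 : C(stdSimplex ℝ ι, ℝ)), ∑ i, a i) ∈ W :=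
    V.le_latticeClosure ⟨1, by rw [formPair_apply, simplexForm_one]; simp⟩
  have hbound : |g - h| ≤ ε • (1 : C(stdSimplex ℝ ι, ℝ)) := fun x => by
    change |(g - h) x| ≤ ε * 1
    rw [mul_one]
    exact ((g - h).norm_coe_le_norm x).trans hgh.le
  -- Positivity transfers for `ε • (1, ∑ i, a i) - |(g, f) - (h, d)|`.
  exact sub_nonneg.1 (hpos _ (W.sub_mem (W.smul_mem ε hone)
    (V.abs_mem_latticeClosure (W.sub_mem hg hhd))) (sub_nonneg.2 hbound))

end Transfer

/-! ### Relatively uniform convergence and conclusion -/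

section RelativelyUniform

variable {F : Type*} [AddCommGroup F] [Lattice F] [Module ℝ F]

lemma relNorm_le {e f : F} {α : ℝ} (hα : 0 ≤ α) (h : |f| ≤ α • e) : relNorm e f ≤ α :=
  csInf_le ⟨0, fun _ hβ => hβ.1⟩ ⟨hα, h⟩

lemma ConvergesUniformlyRel.of_abs_sub_le [IsOrderedAddMonoid F] [IsOrderedModule ℝ F] {e f : F}
    {u : ℕ → F} (hf : |f| ≤ e) (hu : ∀ n : ℕ, |f - u n| ≤ (1 / ((n : ℝ) + 1)) • e) :
    ConvergesUniformlyRel e u f := by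
  have he : 0 ≤ e := (abs_nonneg f).trans hf
  refine ⟨⟨1, zero_le_one, by rwa [one_smul]⟩, fun ε hε => ?_⟩
  obtain ⟨N, hN⟩ := exists_nat_one_div_lt hε
  refine ⟨N, fun n hn => ⟨⟨1 + 1 / ((n : ℝ) + 1), by positivity, ?_⟩, ?_⟩⟩
  · have h : |f - (f - u n)| ≤ |f| + |f - u n| := by
      rw [← abs_neg (f - u n), sub_eq_add_neg f (f - u n)]
      exact abs_add_le _ _
    rw [sub_sub_cancel] at h
    rw [add_smul, one_smul]
    exact h.trans (add_le_add hf (hu n))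
  · exact (relNorm_le (by positivity) (hu n)).trans ((Nat.one_div_le_one_div hn).trans hN.le)

end RelativelyUniform

theorem mainTheorem4 {F : Type*} [AddCommGroup F] [Lattice F] [Module ℝ F]
    [IsOrderedAddMonoid F] [IsOrderedModule ℝ F] (hF : IsArchimedeanVectorLattice F)
    (r s : ℝ) (hrs : s ≠ -r) (A : Set F) (hA : ∀ a ∈ A, 0 ≤ a) :
    IsRelUniformlyDenseSubspace
      (Submodule.span ℝ (piecewiseLinearMap r s '' (Submodule.span ℝ A : Set F))) (vlt A) := by
  refine ⟨span_image_piecewiseLinearMap_le_vlt r s A, fun f hf => ?_⟩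
  obtain ⟨T, hTA, hfT⟩ := exists_finset_mem_latticeClosure_span (vlt_le_latticeClosure A hf)
  have hT : ∀ i : T, 0 ≤ (i : F) := fun i => hA i (hTA i.2)
  have hrange : range (fun i : T => (i : F)) = T := Subtype.range_coe
  rw [← hrange] at hfT
  choose u huD hu using fun n : ℕ =>
    exists_mem_span_abs_abs_sub_le hT hfT (Nat.one_div_pos_of_nat (α := ℝ) (n := n))
  have he₀ : 0 ≤ ∑ i : T, (i : F) := Finset.sum_nonneg fun i _ => hT i
  have habs : |f| ∈ vlt A := (isSublattice_vlt A).supClosed hf ((vlt A).neg_mem hf)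
  -- The sum controls the errors; adding `|f|` puts `f` in the principal ideal with constant `1`.
  refine ⟨∑ i : T, (i : F) + |f|,
    (vlt A).add_mem (Submodule.sum_mem _ fun i _ => subset_vlt A (hTA i.2)) habs,
    add_nonneg he₀ (abs_nonneg f), ℕ, inferInstance, inferInstance, inferInstance, u,
    fun n => ?_, ConvergesUniformlyRel.of_abs_sub_le (le_add_of_nonneg_left he₀) fun n =>
      (hu n).trans (smul_le_smul_of_nonneg_left (le_add_of_nonneg_right (abs_nonneg f))
        Nat.one_div_pos_of_nat.le)⟩
  refine Submodule.span_le.2 ?_ (huD n)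
  rintro _ ⟨v, hv, rfl⟩
  rw [hrange] at hv
  exact abs_mem_span_image_piecewiseLinearMap hrs _ (Submodule.span_mono hTA hv)
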